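/- Let $n\ge 2$ and $0\le k<n$ be integers, and put $m_1=\binom{n-2}{k-1}$ (which is $0$ if $k=0$), $m_2=\binom{n-2}{k}$ and $m_3=\binom{n-1}{k}$. Let $T$ be a $k$-dimensional $\mathbb{Q}$-acyclic simplicial complex on $[n]=\{1,\dots,n\}$, that is, a $k$-dimensional simplicial complex that has a full $(k-1)$-skeleton (every non-empty subset of $[n]$ with at most $k$ elements is a face), has exactly $\binom{n-1}{k}$ faces of dimension $k$, and satisfies $\tilde H_k(T;\mathbb{Q})=0$. Let $i\in[n]$ and let $d$ be the degree of $i$, that is, the number of $k$-dimensional faces of $T$ that contain $i$. Then $m_1\le d\le m_3$, the reduced integral homology group $\tilde H_{k-1}(T)=\tilde H_{k-1}(T;\mathbb{Z})$ is finite, and $$|\tilde H_{k-1}(T)|^2\le\begin{cases}\left(\dfrac{d-m_1}{m_2}\right)^{m_1}\left(1+\dfrac{k}{n-1}\cdot\dfrac{m_3-d}{d-m_1}\right)^{d}(k+1)^{m_3-d}, & d>m_1,\\[2mm] \left(\dfrac{k}{n-1}\right)^{m_1}(k+1)^{m_2}, & d=m_1,\end{cases}$$ where $0^0=1$. -/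

import Mathlib

namespace QAcyclic

open Finset

variable {n : ℕ}

open Classical in
/-- The faces of `T` with `s` vertices, that is, of dimension `s - 1`. The empty set counts as the
unique face of dimension `-1`, as is customary for reduced homology. -/
noncomputable def facesOfCard (T : PreAbstractSimplicialComplex (Fin n)) (s : ℕ) :
    Finset (Finset (Fin n)) :=
  {σ | #σ = s ∧ (σ = ∅ ∨ σ ∈ T.faces)}

/-- The entry `∂(σ, τ)` of the boundary matrix: it is `(-1)^m` if `σ` arises from
`τ = {τ_0 < τ_1 < ⋯}` by deleting `τ_m`, and `0` otherwise. -/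
def incidence (R : Type*) [CommRing R] (σ τ : Finset (Fin n)) : R :=
  ∑ i ∈ τ, if σ = τ.erase i then (-1) ^ #{j ∈ τ | j < i} else 0

/-- The module of reduced simplicial `(s - 1)`-chains of `T` with coefficients in `R`. -/
abbrev Chains (R : Type*) [CommRing R] (T : PreAbstractSimplicialComplex (Fin n)) (s : ℕ) :
    Type _ :=
  facesOfCard T s → R

/-- The boundary map from `s`-dimensional chains (faces with `s + 1` vertices) to
`(s - 1)`-dimensional chains (faces with `s` vertices). -/
noncomputable def boundary (R : Type*) [CommRing R] (T : PreAbstractSimplicialComplex (Fin n))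
    (s : ℕ) : Chains R T (s + 1) →ₗ[R] Chains R T s :=
  (Matrix.of fun (σ : facesOfCard T s) (τ : facesOfCard T (s + 1)) =>
    incidence R σ.1 τ.1).mulVecLin

/-- The reduced `(s - 1)`-cycles. All chains of dimension `-1` are cycles. -/
noncomputable def cycles (R : Type*) [CommRing R] (T : PreAbstractSimplicialComplex (Fin n)) :
    (s : ℕ) → Submodule R (Chains R T s)
  | 0 => ⊤
  | s + 1 => LinearMap.ker (boundary R T s)

/-- The reduced `(s - 1)`-boundaries. -/
noncomputable def boundaries (R : Type*) [CommRing R] (T : PreAbstractSimplicialComplex (Fin n))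
    (s : ℕ) : Submodule R (Chains R T s) :=
  LinearMap.range (boundary R T s)

/-- The reduced simplicial homology `H̃_{s-1}(T; R)`: cycles modulo boundaries. The index is
shifted by one, so that `s = 0` gives `H̃_{-1}`. -/
abbrev ReducedHomology (R : Type*) [CommRing R] (T : PreAbstractSimplicialComplex (Fin n))
    (s : ℕ) : Type _ :=
  cycles R T s ⧸ (boundaries R T s).comap (cycles R T s).subtype

/-- `T` is a `k`-dimensional `ℚ`-acyclic simplicial complex on `n` vertices. -/
structure IsQAcyclic (T : PreAbstractSimplicialComplex (Fin n)) (k : ℕ) : Prop where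
  /-- no face has dimension greater than `k` -/
  card_le : ∀ σ ∈ T.faces, #σ ≤ k + 1
  /-- some face has dimension `k` -/
  exists_face : ∃ σ ∈ T.faces, #σ = k + 1
  /-- the `(k - 1)`-skeleton is full -/
  full_skeleton : ∀ σ : Finset (Fin n), σ.Nonempty → #σ ≤ k → σ ∈ T.faces
  /-- the number of `k`-faces -/
  card_faces : #(facesOfCard T (k + 1)) = (n - 1).choose k
  /-- `H̃_k(T; ℚ) = 0` -/
  homology_top : Subsingleton (ReducedHomology ℚ T (k + 1))

/-- The degree of the vertex `i` in a `k`-dimensional complex: the number of `k`-faces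
containing `i`. -/
noncomputable def degree (T : PreAbstractSimplicialComplex (Fin n)) (k : ℕ) (i : Fin n) : ℕ :=
  #{τ ∈ facesOfCard T (k + 1) | i ∈ τ}

/-- The binomial coefficient `m₁ = C(n-2, k-1)`, which is `0` for `k = 0`. -/
def m₁ (n : ℕ) : ℕ → ℕ
  | 0 => 0
  | k + 1 => (n - 2).choose k

/-- The binomial coefficient `m₂ = C(n-2, k)`. -/
def m₂ (n k : ℕ) : ℕ := (n - 2).choose k

/-- The binomial coefficient `m₃ = C(n-1, k)`. -/
def m₃ (n k : ℕ) : ℕ := (n - 1).choose k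

end QAcyclic

/-! Let `M` be the boundary matrix of `T` in degree `k` without the rows of the faces through `i`. A
`(k-1)`-cycle is determined by its values on the `k`-sets avoiding `i`, and these values are
arbitrary because every chain there extends by coning from `i`. Hence homology is the cokernel of
the square matrix `M`; acyclicity over ℚ gives `det M ≠ 0`, so the group is finite of order `|det
M|`.

Let `Q` be the orthogonal projection onto the coboundaries of the full simplex on the other `n - 1`
vertices; its trace is `m₁`. A column of `M` belonging to a face that avoids `i` is a boundary in
that simplex, so `Q` kills it, and its squared norm is `k + 1`. A column of a face through `i` is a
signed unit vector `±u`, with `⟨u, Q u⟩ = k / (n - 1)`. Since `1 + (√s - 1) Q` has determinant `√s ^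
m₁`, Hadamard's inequality for `(1 + (√s - 1) Q) M` gives, for every `s > 0`, the bound `s ^ m₁ *
det² ≤ (1 + (s - 1) k / (n - 1)) ^ d * (k + 1) ^ (m₃ - d)`, which is `pow_mul_det_sq_le`.

Everything follows from the choice of `s`: large `s` excludes `d < m₁`, the limit `s → ∞` settles `d
= m₁`, and `s = m₂ / (d - m₁)` settles `d > m₁`. -/

namespace QAcyclic

open Finset

variable {n : ℕ}

/-! ### Determinants: Hadamard's inequality, perturbed projections, orders of cokernels. -/

section MatrixLemmas

variable {ι : Type*} [Fintype ι] [DecidableEq ι]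

/-- Hadamard's inequality for positive definite real matrices. -/
theorem det_le_prod_diag {A : Matrix ι ι ℝ} (hA : A.PosDef) : A.det ≤ ∏ j, A j j := by
  have hpos : ∀ j, 0 < A j j := fun j => hA.diag_pos
  -- Rescaling rows and columns reduces to unit diagonal, where the eigenvalues sum to the size of
  -- the matrix.
  set c : ι → ℝ := fun j => (Real.sqrt (A j j))⁻¹ with hc
  have hcc : ∀ j, c j * A j j * c j = 1 := by
    intro j
    have h1 : Real.sqrt (A j j) ≠ 0 := (Real.sqrt_pos.2 (hpos j)).ne'
    have h2 := Real.mul_self_sqrt (hpos j).le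
    simp only [hc]
    field_simp
    nlinarith
  have hB : (Matrix.diagonal c * A * Matrix.diagonal c).PosSemidef := by
    have := hA.posSemidef.mul_mul_conjTranspose_same (Matrix.diagonal c)
    simpa [Matrix.diagonal_conjTranspose] using this
  set B := Matrix.diagonal c * A * Matrix.diagonal c with hBdef
  have hdiag : ∀ j, B j j = 1 := by
    intro j
    simp [hBdef, Matrix.mul_diagonal, Matrix.diagonal_mul, hcc]
  have htr : ∑ j, hB.1.eigenvalues j = ∑ _j : ι, (1 : ℝ) := by
    have := hB.1.trace_eq_sum_eigenvalues
    simp only [RCLike.ofReal_real_eq_id, id] at this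
    rw [← this]
    exact Finset.sum_congr rfl fun j _ => hdiag j
  have hdet : B.det ≤ 1 := by
    rw [hB.1.det_eq_prod_eigenvalues]
    simp only [RCLike.ofReal_real_eq_id, id]
    -- The bound `x ≤ exp (x - 1)` replaces the arithmetic-geometric mean inequality.
    calc ∏ j, hB.1.eigenvalues j ≤ ∏ j, Real.exp (hB.1.eigenvalues j - 1) := by
          refine Finset.prod_le_prod (fun j _ => hB.eigenvalues_nonneg j) fun j _ => ?_
          linarith [Real.add_one_le_exp (hB.1.eigenvalues j - 1)]
      _ = 1 := by rw [← Real.exp_sum, Finset.sum_sub_distrib, htr, sub_self, Real.exp_zero]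
  have hprod : (∏ j, c j) * (∏ j, c j) * ∏ j, A j j = 1 := by
    rw [← Finset.prod_mul_distrib, ← Finset.prod_mul_distrib]
    exact Finset.prod_eq_one fun j _ => by rw [← hcc j]; ring
  have hdetB : B.det = (∏ j, c j) * (∏ j, c j) * A.det := by
    simp only [hBdef, Matrix.det_mul, Matrix.det_diagonal]; ring
  have hP : 0 < ∏ j, A j j := Finset.prod_pos fun j _ => hpos j
  calc A.det = B.det * ∏ j, A j j := by
        rw [hdetB]; linear_combination (-A.det) * hprod
    _ ≤ 1 * ∏ j, A j j := by gcongr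
    _ = _ := one_mul _

/-- Hadamard's inequality for the columns of a real square matrix. -/
theorem det_sq_le_prod_col (A : Matrix ι ι ℝ) : A.det ^ 2 ≤ ∏ j, (A.transpose * A) j j := by
  by_cases h : A.det = 0
  · rw [h, zero_pow two_ne_zero]
    refine Finset.prod_nonneg fun j _ => ?_
    rw [Matrix.mul_apply]
    exact Finset.sum_nonneg fun i _ => mul_self_nonneg _
  · have hpd : (A.transpose * A).PosDef := by
      have := Matrix.PosDef.conjTranspose_mul_self A
        (Matrix.mulVec_injective_iff_isUnit.2 ((Matrix.isUnit_iff_isUnit_det A).2 (isUnit_iff_ne_zero.2 h)))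
      simpa [Matrix.conjTranspose_eq_transpose_of_trivial] using this
    calc A.det ^ 2 = (A.transpose * A).det := by rw [Matrix.det_mul, Matrix.det_transpose, sq]
      _ ≤ _ := det_le_prod_diag hpd

/-- The determinant of `1 + (t - 1) Q` for an orthogonal projection `Q` of trace `r`. -/
theorem det_one_add_smul_projection {Q : Matrix ι ι ℝ} (hQ : Q.IsHermitian) (hQQ : Q * Q = Q)
    (r : ℕ) (hr : Q.trace = r) (t : ℝ) : (1 + (t - 1) • Q).det = t ^ r := by
  have heig : ∀ j, hQ.eigenvalues j = 0 ∨ hQ.eigenvalues j = 1 := by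
    intro j
    have h1 := hQ.mulVec_eigenvectorBasis j
    set v : ι → ℝ := WithLp.ofLp (hQ.eigenvectorBasis j) with hv
    set l := hQ.eigenvalues j
    have h2 : Q.mulVec (Q.mulVec v) = Q.mulVec v := by rw [Matrix.mulVec_mulVec, hQQ]
    rw [h1, Matrix.mulVec_smul, h1, smul_smul] at h2
    have hne : v ≠ 0 := by
      intro h0
      have := hQ.eigenvectorBasis.orthonormal.ne_zero j
      exact this (by ext x; simpa [hv] using congrFun h0 x)
    have h3 : (l * l - l) • v = 0 := by rw [sub_smul, h2, sub_self]
    have h4 : l * (l - 1) = 0 := by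
      rcases smul_eq_zero.1 h3 with h | h
      · linarith
      · exact absurd h hne
    rcases mul_eq_zero.1 h4 with h | h
    · exact Or.inl h
    · exact Or.inr (by linarith)
  have hdet : (1 + (t - 1) • Q).det = ∏ j, (1 + (t - 1) * hQ.eigenvalues j) := by
    have hs := hQ.spectral_theorem
    set U := hQ.eigenvectorUnitary
    have hU : (U : Matrix ι ι ℝ) * star (U : Matrix ι ι ℝ) = 1 := Unitary.mul_star_self_of_mem U.2
    have : 1 + (t - 1) • Q = (U : Matrix ι ι ℝ) *
        Matrix.diagonal (fun j => 1 + (t - 1) * hQ.eigenvalues j) * star (U : Matrix ι ι ℝ) := by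
      have hd : Matrix.diagonal (fun j => 1 + (t - 1) * hQ.eigenvalues j) =
          1 + (t - 1) • Matrix.diagonal (hQ.eigenvalues) := by
        ext a b
        by_cases hab : a = b
        · subst hab; simp
        · simp [hab]
      rw [hd, mul_add, add_mul, mul_one, hU]
      conv_lhs => rw [hs]
      simp [Unitary.conjStarAlgAut_apply]
    rw [this, Matrix.det_mul, Matrix.det_mul, mul_right_comm, ← Matrix.det_mul, hU,
      Matrix.det_one, one_mul, Matrix.det_diagonal]
  have hpow : ∀ j, 1 + (t - 1) * hQ.eigenvalues j = t ^ (if hQ.eigenvalues j = 1 then 1 else 0) := by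
    intro j
    rcases heig j with h | h <;> simp [h]
  have hsum : (∑ j, (if hQ.eigenvalues j = 1 then 1 else 0) : ℕ) = r := by
    have h := hQ.trace_eq_sum_eigenvalues
    simp only [RCLike.ofReal_real_eq_id, id] at h
    rw [hr] at h
    have h' : (r : ℝ) = ((∑ j, (if hQ.eigenvalues j = 1 then 1 else 0) : ℕ) : ℝ) := by
      rw [h, Nat.cast_sum]
      refine Finset.sum_congr rfl fun j _ => ?_
      rcases heig j with h | h <;> simp [h]
    exact_mod_cast h'.symm
  rw [hdet, Finset.prod_congr rfl fun j _ => hpow j, Finset.prod_pow_eq_pow_sum, hsum]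

/-- The cokernel of an integer matrix of nonzero determinant has order `|det|`. -/
theorem natCard_quotient_range_mulVecLin (M : Matrix ι ι ℤ) (hM : M.det ≠ 0) :
    Nat.card ((ι → ℤ) ⧸ LinearMap.range M.mulVecLin) = M.det.natAbs := by
  have hinj : Function.Injective M.mulVecLin :=
    Matrix.mulVec_injective_of_det_ne_zero hM
  have := Submodule.natAbs_det_equiv (LinearMap.range M.mulVecLin)
    (LinearEquiv.ofInjective M.mulVecLin hinj)
  rw [← this, ← LinearMap.det_toLin']
  rfl

end MatrixLemmas

/-! ### Anticommutation relations for vertex removal, and the Laplacian of a simplex. -/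

section Annihilation

variable (R : Type*) [CommRing R]

/-- The sign `(-1) ^ #{l ∈ σ | l < j}`. -/
def vertexSign (j : Fin n) (σ : Finset (Fin n)) : R := (-1) ^ #{l ∈ σ | l < j}

/-- The matrix of the operator removing the vertex `j` with the usual sign. -/
def removal (j : Fin n) : Matrix (Finset (Fin n)) (Finset (Fin n)) R :=
  Matrix.of fun σ τ => if j ∈ τ ∧ σ = τ.erase j then vertexSign R j τ else 0

theorem vertexSign_mul_self (j : Fin n) (σ : Finset (Fin n)) :
    vertexSign R j σ * vertexSign R j σ = 1 := by
  rw [vertexSign, ← mul_pow]; simp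

theorem vertexSign_insert {j l : Fin n} {σ : Finset (Fin n)} (hl : l ∉ σ) :
    vertexSign R j (insert l σ) = (if l < j then -1 else 1) * vertexSign R j σ := by
  unfold vertexSign
  rw [filter_insert]
  split_ifs with h
  · rw [card_insert_of_notMem (by simp [hl]), pow_succ]; ring
  · simp

theorem removal_apply' (j : Fin n) (σ τ : Finset (Fin n)) :
    removal R j σ τ = if j ∉ σ ∧ τ = insert j σ then vertexSign R j σ else 0 := by
  simp only [removal, Matrix.of_apply]
  by_cases h : j ∈ τ ∧ σ = τ.erase j
  · obtain ⟨h1, rfl⟩ := h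
    rw [if_pos ⟨h1, rfl⟩, if_pos ⟨notMem_erase _ _, (insert_erase h1).symm⟩]
    conv_lhs => rw [← insert_erase h1]
    rw [vertexSign_insert R (notMem_erase _ _)]; simp
  · rw [if_neg h, if_neg]
    rintro ⟨h1, rfl⟩
    exact h ⟨mem_insert_self _ _, (erase_insert h1).symm⟩

theorem incidence_eq_sum_removal (σ τ : Finset (Fin n)) :
    incidence R σ τ = ∑ j, removal R j σ τ := by
  rw [incidence, ← Finset.sum_filter_add_sum_filter_not univ (· ∈ τ)]
  rw [Finset.sum_eq_zero (s := univ.filter (¬ · ∈ τ)), add_zero]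
  · refine Finset.sum_congr (by ext; simp) fun j hj => ?_
    simp [removal, (mem_filter.1 hj).2, vertexSign]
  · intro j hj
    simp only [mem_filter] at hj
    simp [removal, hj.2]

theorem sum_removal_mul (j : Fin n) (σ : Finset (Fin n)) (f : Finset (Fin n) → R) :
    ∑ ρ, removal R j σ ρ * f ρ = if j ∉ σ then vertexSign R j σ * f (insert j σ) else 0 := by
  simp only [removal_apply']
  split_ifs with h
  · simp [h]
  · simp [h]

theorem sum_removal_left_mul (j : Fin n) (τ : Finset (Fin n)) (f : Finset (Fin n) → R) :
    ∑ ρ, removal R j ρ τ * f ρ = if j ∈ τ then vertexSign R j τ * f (τ.erase j) else 0 := by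
  simp only [removal, Matrix.of_apply]
  split_ifs with h
  · simp [h]
  · simp [h]

/-- Removing two vertices in opposite orders changes the sign, since removing the smaller one first
shifts the position of the larger by one. -/
theorem removal_mul_removal (i j : Fin n) :
    removal R i * removal R j + removal R j * removal R i = 0 := by
  ext σ τ
  rw [Matrix.add_apply, Matrix.mul_apply, Matrix.mul_apply, sum_removal_mul, sum_removal_mul,
    removal_apply', removal_apply', Matrix.zero_apply]
  rcases eq_or_ne i j with rfl | hij
  · simp
  by_cases hi : i ∈ σ
  · simp [hi]
  by_cases hj : j ∈ σ
  · simp [hj]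
  have h1 : j ∉ insert i σ := by simp [hj, hij.symm]
  have h2 : i ∉ insert j σ := by simp [hi, hij]
  rw [if_pos hi, if_pos hj]
  by_cases hτ : τ = insert i (insert j σ)
  · subst hτ
    rw [if_pos ⟨h1, insert_comm _ _ _⟩, if_pos ⟨h2, rfl⟩, vertexSign_insert R hi, vertexSign_insert R hj]
    rcases lt_or_gt_of_ne hij with h | h
    · simp [h, h.not_gt]; ring
    · simp [h, h.not_gt]; ring
  · rw [if_neg (fun h => hτ (h.2.trans (insert_comm _ _ _))), if_neg (fun h => hτ h.2)]; simp

/-- The transpose inserts a vertex. For `i = j` exactly one of the two products acts on a given set,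
with sign squared; for `i ≠ j` the two orders cancel. -/
theorem removal_mul_transpose (i j : Fin n) :
    removal R i * (removal R j).transpose + (removal R j).transpose * removal R i =
      if i = j then 1 else 0 := by
  ext σ τ
  rw [Matrix.add_apply, Matrix.mul_apply, Matrix.mul_apply]
  simp only [Matrix.transpose_apply]
  rw [sum_removal_mul, sum_removal_left_mul]
  rcases eq_or_ne i j with rfl | hij
  · rw [if_pos rfl, Matrix.one_apply]
    by_cases hi : i ∈ σ
    · rw [if_neg (by simpa using hi), if_pos hi, removal_apply', zero_add, insert_erase hi]
      have h : vertexSign R i (σ.erase i) = vertexSign R i σ := by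
        conv_rhs => rw [← insert_erase hi, vertexSign_insert R (notMem_erase _ _)]
        simp
      by_cases hτ : σ = τ
      · subst hτ; simp [h, vertexSign_mul_self]
      · simp [hτ, Ne.symm hτ]
    · rw [if_pos hi, if_neg hi, removal_apply', add_zero]
      by_cases hτ : σ = τ
      · subst hτ; simp [hi, vertexSign_mul_self]
      · rw [if_neg, mul_zero, if_neg hτ]
        rintro ⟨h1, h2⟩
        exact hτ (by rw [← erase_insert hi, h2, erase_insert h1])
  · rw [if_neg hij, Matrix.zero_apply]
    by_cases hi : i ∈ σ
    · rw [if_neg (by simpa using hi), zero_add]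
      split_ifs with hj
      · rw [removal_apply', if_neg (by simp [hi, hij]), mul_zero]
      · rfl
    rw [if_pos hi]
    by_cases hj : j ∈ σ
    · obtain ⟨ρ, hρ, rfl⟩ : ∃ ρ, j ∉ ρ ∧ σ = insert j ρ :=
        ⟨σ.erase j, notMem_erase _ _, (insert_erase hj).symm⟩
      have hi' : i ∉ ρ := fun h => hi (mem_insert_of_mem h)
      rw [if_pos hj, erase_insert hρ, removal_apply' R i ρ τ, insert_comm, removal, Matrix.of_apply,
        erase_insert (by simp [hρ, hij.symm])]
      by_cases hτ : τ = insert i ρ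
      · subst hτ
        rw [if_pos (by simp), if_pos ⟨hi', rfl⟩, vertexSign_insert R hρ,
          vertexSign_insert R (by simp [hρ, hij.symm]), vertexSign_insert R hi',
          vertexSign_insert R hρ]
        rcases lt_or_gt_of_ne hij with h | h
        · simp [h, h.not_gt]; ring
        · simp [h, h.not_gt]; ring
      · rw [if_neg (fun h => hτ h.2), if_neg (fun h => hτ h.2)]; simp
    · rw [if_neg hj, add_zero, removal, Matrix.of_apply, if_neg, mul_zero]
      simp [hj, hij.symm]

/-- The boundary matrix on all subsets of the vertices in `V`. -/
def boundaryOn (V : Finset (Fin n)) : Matrix (Finset (Fin n)) (Finset (Fin n)) R :=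
  ∑ j ∈ V, removal R j

theorem boundaryOn_mul_self (V : Finset (Fin n)) [NoZeroDivisors R] [CharZero R] :
    boundaryOn R V * boundaryOn R V = 0 := by
  -- Anticommutation shows that twice the square vanishes; the hypotheses on `R` allow division by
  -- 2.
  have h : boundaryOn R V * boundaryOn R V + boundaryOn R V * boundaryOn R V = 0 := by
    simp only [boundaryOn, sum_mul_sum]
    conv_lhs => enter [2]; rw [Finset.sum_comm]
    rw [← sum_add_distrib]
    refine sum_eq_zero fun i _ => ?_
    rw [← sum_add_distrib]
    exact sum_eq_zero fun j _ => by rw [removal_mul_removal]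
  ext σ τ
  have := congrFun (congrFun h σ) τ
  rw [Matrix.add_apply, Matrix.zero_apply] at this
  exact add_self_eq_zero.1 this

/-- Only the diagonal anticommutators survive, one identity matrix for each vertex of `V`. This
makes a multiple of `∂ᵀ∂` a projection. -/
theorem boundaryOn_laplacian (V : Finset (Fin n)) :
    boundaryOn R V * (boundaryOn R V).transpose + (boundaryOn R V).transpose * boundaryOn R V =
      (#V : R) • 1 := by
  simp only [boundaryOn, Matrix.transpose_sum, sum_mul_sum]
  rw [Finset.sum_comm (s := V) (t := V), ← sum_add_distrib]
  simp only [← sum_add_distrib, removal_mul_transpose]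
  simp [Nat.cast_smul_eq_nsmul]

theorem removal_eq_zero {j : Fin n} {σ τ : Finset (Fin n)} (h : #τ ≠ #σ + 1) :
    removal R j σ τ = 0 := by
  rw [removal_apply', if_neg]
  rintro ⟨h1, rfl⟩
  exact h (card_insert_of_notMem h1)

theorem boundaryOn_eq_zero_of_card {V σ τ : Finset (Fin n)} (h : #τ ≠ #σ + 1) :
    boundaryOn R V σ τ = 0 := by
  rw [boundaryOn, Matrix.sum_apply]
  exact sum_eq_zero fun j _ => removal_eq_zero R h

theorem boundaryOn_eq_zero_of_mem {V σ τ : Finset (Fin n)} {i : Fin n} (hi : i ∉ V)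
    (h : ¬ (i ∈ σ ↔ i ∈ τ)) : boundaryOn R V σ τ = 0 := by
  rw [boundaryOn, Matrix.sum_apply]
  refine sum_eq_zero fun j hj => ?_
  have : i ≠ j := fun e => hi (e ▸ hj)
  rw [removal_apply', if_neg]
  rintro ⟨h1, rfl⟩
  simp [this] at h

theorem incidence_eq_boundaryOn (σ τ : Finset (Fin n)) :
    incidence R σ τ = boundaryOn R univ σ τ := by
  rw [incidence_eq_sum_removal, boundaryOn, Matrix.sum_apply]

theorem boundaryOn_univ (i : Fin n) :
    boundaryOn R univ = removal R i + boundaryOn R (univ.erase i) := by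
  rw [boundaryOn, boundaryOn, add_sum_erase _ _ (mem_univ i)]

/-- The sum of the squared entries of a column of the boundary matrix. -/
theorem transpose_boundaryOn_mul_self_diag (V τ : Finset (Fin n)) :
    ((boundaryOn R V).transpose * boundaryOn R V) τ τ = #(V ∩ τ) := by
  rw [boundaryOn, Matrix.transpose_sum, sum_mul_sum, Matrix.sum_apply]
  simp only [Matrix.sum_apply, Matrix.mul_apply, Matrix.transpose_apply, sum_removal_left_mul]
  have : ∀ a ∈ V, ∑ b ∈ V, (if a ∈ τ then vertexSign R a τ * removal R b (τ.erase a) τ else 0) =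
      if a ∈ τ then 1 else 0 := by
    intro a ha
    split_ifs with h
    · rw [sum_eq_single a]
      · simp [removal, h, vertexSign_mul_self]
      · intro b _ hb
        rw [removal_apply', if_neg, mul_zero]
        rintro ⟨h1, h2⟩
        have : a ∈ insert b (τ.erase a) := h2 ▸ h
        simp [hb.symm] at this
      · exact fun h => absurd ha h
    · simp
  rw [sum_congr rfl this, sum_ite_mem, sum_const, nsmul_one]

end Annihilation

/-! ### Homology in degree `k - 1` as the cokernel of a square matrix. -/

section Homology

variable {R : Type*} [CommRing R] {T : PreAbstractSimplicialComplex (Fin n)} {k : ℕ}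

theorem mem_facesOfCard {s : ℕ} {σ : Finset (Fin n)} :
    σ ∈ facesOfCard T s ↔ #σ = s ∧ (σ = ∅ ∨ σ ∈ T.faces) := by
  classical
  simp [facesOfCard]

theorem IsQAcyclic.mem_facesOfCard_iff (hT : IsQAcyclic T k) {s : ℕ} (hs : s ≤ k)
    {σ : Finset (Fin n)} : σ ∈ facesOfCard T s ↔ #σ = s := by
  rw [mem_facesOfCard, and_iff_left_iff_imp]
  intro h
  rcases σ.eq_empty_or_nonempty with h0 | h0
  · exact Or.inl h0
  · exact Or.inr (hT.full_skeleton σ h0 (h ▸ hs))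

/-- Extension of a chain by zero to all sets of vertices. -/
noncomputable def extendChain {s : ℕ} (c : Chains R T s) (τ : Finset (Fin n)) : R :=
  open Classical in if h : τ ∈ facesOfCard T s then c ⟨τ, h⟩ else 0

theorem extendChain_mem {s : ℕ} (c : Chains R T s) (τ : facesOfCard T s) :
    extendChain c τ = c τ := by simp [extendChain]

theorem extendChain_of_card_ne {s : ℕ} (c : Chains R T s) {τ : Finset (Fin n)} (h : #τ ≠ s) :
    extendChain c τ = 0 := by
  rw [extendChain, dif_neg]
  exact fun h' => h (mem_facesOfCard.1 h').1

theorem boundary_apply {s : ℕ} (c : Chains R T (s + 1)) (σ : facesOfCard T s) :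
    boundary R T s c σ = (boundaryOn R univ).mulVec (extendChain c) σ.1 := by
  classical
  rw [boundary, Matrix.mulVecLin_apply]
  simp only [Matrix.mulVec, dotProduct, Matrix.of_apply, incidence_eq_boundaryOn]
  rw [← Finset.sum_subset (subset_univ (facesOfCard T (s + 1)))]
  · refine Eq.trans (Fintype.sum_congr _ _ fun τ => ?_) (Finset.sum_coe_sort _ _)
    rw [extendChain_mem]
  · intro τ _ hτ
    simp [extendChain, hτ]

theorem mulVec_apply_eq_zero {α β : Type*} [Fintype β] {M : Matrix α β R} {f : β → R} {a : α}
    (h : ∀ b, M a b * f b = 0) : M.mulVec f a = 0 :=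
  sum_eq_zero fun b _ => h b

theorem mulVec_eq_zero_of_card {s : ℕ} {V : Finset (Fin n)} {f : Finset (Fin n) → R}
    (hf : ∀ τ, #τ ≠ s → f τ = 0) {σ : Finset (Fin n)} (hσ : #σ + 1 ≠ s) :
    (boundaryOn R V).mulVec f σ = 0 := by
  refine mulVec_apply_eq_zero fun τ => ?_
  by_cases h : #τ = s
  · rw [boundaryOn_eq_zero_of_card R (by omega), zero_mul]
  · rw [hf τ h, mul_zero]

/-- For `s ≤ k` every `s`-set is a face, so no entry of the boundary is lost by restricting to `T`.
-/
theorem IsQAcyclic.extendChain_boundary (hT : IsQAcyclic T k) {s : ℕ} (hs : s ≤ k)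
    (c : Chains R T (s + 1)) :
    extendChain (boundary R T s c) = (boundaryOn R univ).mulVec (extendChain c) := by
  ext σ
  by_cases h : #σ = s
  · rw [← boundary_apply c ⟨σ, (hT.mem_facesOfCard_iff hs).2 h⟩]
    exact extendChain_mem _ ⟨σ, (hT.mem_facesOfCard_iff hs).2 h⟩
  · rw [extendChain_of_card_ne _ h,
      mulVec_eq_zero_of_card (fun τ hτ => extendChain_of_card_ne c hτ) (by omega)]

theorem IsQAcyclic.mem_cycles_iff (hT : IsQAcyclic T k) {s : ℕ} (hs : s ≤ k)
    (z : Chains R T s) :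
    z ∈ cycles R T s ↔ (boundaryOn R univ).mulVec (extendChain z) = 0 := by
  cases s with
  | zero =>
    -- In dimension `-1` the right-hand side is automatic as well: the boundary would live on sets
    -- with `-1` elements.
    simp only [cycles, Submodule.mem_top, true_iff]
    ext σ
    exact mulVec_eq_zero_of_card (fun τ hτ => extendChain_of_card_ne z hτ) (by omega)
  | succ s =>
    rw [cycles, LinearMap.mem_ker, ← hT.extendChain_boundary (by omega)]
    constructor
    · intro h
      ext σ
      simp [extendChain, h]
    · intro h
      ext σ
      rw [← extendChain_mem (boundary R T s z) σ, h]; rfl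

/-- The sets of `k` vertices that avoid the vertex `i`. -/
abbrev AvoidingFace (i : Fin n) (k : ℕ) : Type := {σ : Finset (Fin n) // #σ = k ∧ i ∉ σ}

theorem card_avoidingFace (i : Fin n) (k : ℕ) :
    Fintype.card (AvoidingFace i k) = (n - 1).choose k := by
  rw [Fintype.card_subtype]
  have : univ.filter (fun σ : Finset (Fin n) => #σ = k ∧ i ∉ σ) =
      powersetCard k (univ.erase i) := by
    ext σ
    simp [mem_powersetCard, subset_erase, and_comm]
  rw [this, card_powersetCard, card_erase_of_mem (mem_univ i), card_univ, Fintype.card_fin]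

variable (i : Fin n)

/-- A cycle that vanishes on all faces avoiding `i` is zero. -/
theorem eq_zero_of_boundary_eq_zero {z : Finset (Fin n) → R}
    (hz : ∀ τ, i ∉ τ → z τ = 0) (hbd : (boundaryOn R univ).mulVec z = 0) : z = 0 := by
  ext τ
  by_cases hi : i ∈ τ
  -- At `τ.erase i` the only surviving term of the boundary is `± z τ`, since `z` vanishes on sets
  -- avoiding `i`.
  · have h := congrFun hbd (τ.erase i)
    rw [boundaryOn_univ R i, Matrix.add_mulVec, Pi.add_apply] at h
    have h2 : (boundaryOn R (univ.erase i)).mulVec z (τ.erase i) = 0 := by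
      refine mulVec_apply_eq_zero fun ρ => ?_
      by_cases hρ : i ∈ ρ
      · rw [boundaryOn_eq_zero_of_mem R (notMem_erase i univ) (by simp [hρ]), zero_mul]
      · rw [hz ρ hρ, mul_zero]
    rw [h2, add_zero, Matrix.mulVec, dotProduct, sum_removal_mul,
      if_pos (notMem_erase _ _), insert_erase hi] at h
    have := congrArg (vertexSign R i (τ.erase i) * ·) h
    simpa [← mul_assoc, vertexSign_mul_self] using this
  · exact hz τ hi

/-- The boundary of the cone with apex `i` restricts to the given chain. -/
theorem boundary_cone_apply (c : Finset (Fin n) → R) {σ : Finset (Fin n)} (hσ : i ∉ σ) :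
    (boundaryOn R univ).mulVec ((removal R i).transpose.mulVec c) σ = c σ := by
  have hcone : ∀ τ, (removal R i).transpose.mulVec c τ =
      if i ∈ τ then vertexSign R i τ * c (τ.erase i) else 0 := by
    intro τ
    rw [← sum_removal_left_mul]; rfl
  rw [boundaryOn_univ R i, Matrix.add_mulVec, Pi.add_apply]
  have h2 : (boundaryOn R (univ.erase i)).mulVec ((removal R i).transpose.mulVec c) σ = 0 := by
    refine mulVec_apply_eq_zero fun ρ => ?_
    by_cases hρ : i ∈ ρ
    · rw [boundaryOn_eq_zero_of_mem R (notMem_erase i univ) (by simp [hρ, hσ]), zero_mul]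
    · rw [hcone, if_neg hρ, mul_zero]
  rw [h2, add_zero, Matrix.mulVec, dotProduct, sum_removal_mul, if_pos hσ, hcone,
    if_pos (mem_insert_self _ _), erase_insert hσ, vertexSign_insert R hσ]
  simp [← mul_assoc, vertexSign_mul_self]

variable (R) in
/-- Restriction of `(k - 1)`-chains to the faces that avoid `i`. -/
noncomputable def restrictAvoiding (hT : IsQAcyclic T k) :
    Chains R T k →ₗ[R] (AvoidingFace i k → R) :=
  LinearMap.funLeft R R fun σ => ⟨σ.1, (hT.mem_facesOfCard_iff le_rfl).2 σ.2.1⟩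

theorem restrictAvoiding_apply (hT : IsQAcyclic T k) (z : Chains R T k) (σ : AvoidingFace i k) :
    restrictAvoiding R i hT z σ = extendChain z σ.1 :=
  (extendChain_mem z ⟨σ.1, (hT.mem_facesOfCard_iff le_rfl).2 σ.2.1⟩).symm

theorem restrictAvoiding_eq_zero (hT : IsQAcyclic T k) {z : Chains R T k}
    (hz : z ∈ cycles R T k) (h : restrictAvoiding R i hT z = 0) : z = 0 := by
  have h0 : extendChain z = 0 := by
    refine eq_zero_of_boundary_eq_zero i (fun τ hτ => ?_) ((hT.mem_cycles_iff le_rfl z).1 hz)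
    by_cases hk : #τ = k
    · rw [← restrictAvoiding_apply i hT z ⟨τ, hk, hτ⟩, h]; rfl
    · exact extendChain_of_card_ne z hk
  ext σ
  rw [← extendChain_mem z σ, h0]; rfl

theorem boundary_mem_cycles [NoZeroDivisors R] [CharZero R] (hT : IsQAcyclic T k) (c : Chains R T (k + 1)) :
    boundary R T k c ∈ cycles R T k := by
  rw [hT.mem_cycles_iff le_rfl, hT.extendChain_boundary le_rfl, Matrix.mulVec_mulVec,
    boundaryOn_mul_self, Matrix.zero_mulVec]

theorem exists_cycle_restrictAvoiding [NoZeroDivisors R] [CharZero R] (hT : IsQAcyclic T k) (c : AvoidingFace i k → R) :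
    ∃ z ∈ cycles R T k, restrictAvoiding R i hT z = c := by
  set c' : Finset (Fin n) → R := fun σ => if h : #σ = k ∧ i ∉ σ then c ⟨σ, h⟩ else 0 with hc'
  -- The cycle is the boundary of the cone over `c'`. The cone may use `(k + 1)`-sets that are not
  -- faces of `T`, but its boundary lies in the full skeleton.
  set f := (boundaryOn R univ).mulVec ((removal R i).transpose.mulVec c') with hf
  have hfk : ∀ σ, #σ ≠ k → f σ = 0 := by
    intro σ hσ
    refine mulVec_eq_zero_of_card (s := k + 1) (fun τ hτ => ?_) (by omega)
    refine mulVec_apply_eq_zero fun ρ => ?_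
    by_cases hρ : #ρ = k
    · rw [Matrix.transpose_apply, removal_eq_zero R (by omega), zero_mul]
    · simp [hc', hρ]
  have hext : extendChain (T := T) (s := k) (fun σ => f σ.1) = f := by
    ext σ
    rw [extendChain]
    split_ifs with h
    · rfl
    · exact (hfk σ fun h' => h ((hT.mem_facesOfCard_iff le_rfl).2 h')).symm
  refine ⟨fun σ => f σ.1, ?_, ?_⟩
  · rw [hT.mem_cycles_iff le_rfl, hext, hf, Matrix.mulVec_mulVec, boundaryOn_mul_self,
      Matrix.zero_mulVec]
  · ext σ
    rw [restrictAvoiding_apply, hext, hf, boundary_cone_apply i c' σ.2.2]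
    simp [hc', σ.2.1, σ.2.2]

/-- Restriction identifies the `(k - 1)`-cycles with the chains on the faces avoiding `i`. -/
noncomputable def cyclesEquiv [NoZeroDivisors R] [CharZero R] (hT : IsQAcyclic T k) :
    cycles R T k ≃ₗ[R] (AvoidingFace i k → R) :=
  LinearEquiv.ofBijective ((restrictAvoiding R i hT).comp (cycles R T k).subtype) <| by
    constructor
    · rw [← LinearMap.ker_eq_bot, LinearMap.ker_eq_bot']
      intro z hz
      exact Subtype.ext (restrictAvoiding_eq_zero i hT z.2 hz)
    · intro c
      obtain ⟨z, hz, rfl⟩ := exists_cycle_restrictAvoiding i hT c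
      exact ⟨⟨z, hz⟩, rfl⟩

variable (R) in
/-- The boundary matrix of `T` with the rows of the faces containing `i` deleted, made square by
an enumeration of the `k`-faces. -/
noncomputable def reducedBoundary (e : AvoidingFace i k ≃ facesOfCard T (k + 1)) :
    Matrix (AvoidingFace i k) (AvoidingFace i k) R :=
  Matrix.of fun σ j => boundaryOn R univ σ.1 (e j).1

theorem reducedBoundary_mulVec (hT : IsQAcyclic T k)
    (e : AvoidingFace i k ≃ facesOfCard T (k + 1)) (x : AvoidingFace i k → R) :
    (reducedBoundary R i e).mulVec x =
      restrictAvoiding R i hT (boundary R T k (fun τ => x (e.symm τ))) := by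
  ext σ
  change _ = boundary R T k _ ⟨σ.1, _⟩
  rw [boundary, Matrix.mulVecLin_apply, Matrix.mulVec, Matrix.mulVec, dotProduct, dotProduct]
  refine Fintype.sum_equiv e _ _ fun j => ?_
  simp [reducedBoundary, incidence_eq_boundaryOn]

/-- The homology group as the cokernel of the reduced boundary matrix. -/
theorem nonempty_homology_equiv [NoZeroDivisors R] [CharZero R] (hT : IsQAcyclic T k)
    (e : AvoidingFace i k ≃ facesOfCard T (k + 1)) :
    Nonempty (ReducedHomology R T k ≃ₗ[R]
      ((AvoidingFace i k → R) ⧸ LinearMap.range (reducedBoundary R i e).mulVecLin)) := by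
  refine ⟨Submodule.Quotient.equiv _ _ (cyclesEquiv i hT) ?_⟩
  ext y
  constructor
  · rintro ⟨z, ⟨c, hc⟩, rfl⟩
    refine ⟨fun j => c (e j), ?_⟩
    rw [Matrix.mulVecLin_apply, reducedBoundary_mulVec i hT]
    simp only [Equiv.apply_symm_apply]
    change restrictAvoiding R i hT (boundary R T k c) = restrictAvoiding R i hT z.1
    rw [hc]; rfl
  · rintro ⟨x, rfl⟩
    rw [Matrix.mulVecLin_apply, reducedBoundary_mulVec i hT]
    exact ⟨⟨_, boundary_mem_cycles hT _⟩, ⟨_, rfl⟩, rfl⟩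

/-- There are no faces of dimension `k + 1`, so vanishing homology leaves no nonzero `k`-cycles. -/
theorem IsQAcyclic.boundary_rat_injective (hT : IsQAcyclic T k) {c : Chains ℚ T (k + 1)}
    (hc : boundary ℚ T k c = 0) : c = 0 := by
  have := hT.homology_top
  have hmem : c ∈ cycles ℚ T (k + 1) := hc
  have h := (Submodule.Quotient.mk_eq_zero _).1
    (Subsingleton.elim (Submodule.Quotient.mk ⟨c, hmem⟩ : ReducedHomology ℚ T (k + 1)) 0)
  obtain ⟨b, hb⟩ := h
  have hempty : IsEmpty (facesOfCard T (k + 1 + 1)) := by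
    refine ⟨fun τ => ?_⟩
    obtain ⟨h1, h2⟩ := mem_facesOfCard.1 τ.2
    rcases h2 with h2 | h2
    · simp [h2] at h1
    · have := hT.card_le _ h2
      omega
  rw [Subsingleton.elim b 0, map_zero] at hb
  exact hb.symm

/-- An integer kernel vector yields a `k`-chain whose boundary is a cycle vanishing off `i`, hence
zero; read over ℚ, the chain is then zero. -/
theorem det_reducedBoundary_ne_zero (hT : IsQAcyclic T k)
    (e : AvoidingFace i k ≃ facesOfCard T (k + 1)) : (reducedBoundary ℤ i e).det ≠ 0 := by
  intro h
  obtain ⟨v, hv, hMv⟩ := Matrix.exists_mulVec_eq_zero_iff.2 h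
  rw [reducedBoundary_mulVec i hT] at hMv
  have h0 := restrictAvoiding_eq_zero i hT (boundary_mem_cycles hT _) hMv
  have hq : boundary ℚ T k (fun τ => (v (e.symm τ) : ℚ)) = 0 := by
    ext σ
    have := congrArg (Int.cast (R := ℚ)) (congrFun h0 σ)
    rw [boundary, Matrix.mulVecLin_apply, Matrix.mulVec, dotProduct] at this ⊢
    simpa [incidence, apply_ite (Int.cast (R := ℚ))] using this
  have hz := hT.boundary_rat_injective hq
  refine hv (funext fun j => ?_)
  have := congrFun hz (e j)
  simpa using this

theorem card_homology (hT : IsQAcyclic T k) (e : AvoidingFace i k ≃ facesOfCard T (k + 1)) :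
    Nat.card (ReducedHomology ℤ T k) = (reducedBoundary ℤ i e).det.natAbs := by
  obtain ⟨f⟩ := nonempty_homology_equiv (R := ℤ) i hT e
  rw [Nat.card_congr f.toEquiv,
    natCard_quotient_range_mulVecLin _ (det_reducedBoundary_ne_zero i hT e)]

theorem det_reducedBoundary_real (e : AvoidingFace i k ≃ facesOfCard T (k + 1)) :
    (reducedBoundary ℝ i e).det = ((reducedBoundary ℤ i e).det : ℝ) := by
  refine Eq.trans ?_ (RingHom.map_det (Int.castRingHom ℝ) _).symm
  congr 1
  ext σ j
  simp [reducedBoundary, ← incidence_eq_boundaryOn, incidence, apply_ite (Int.cast (R := ℝ))]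

end Homology

/-! ### The projection onto coboundaries: idempotence, diagonal and trace. -/

section Projection

variable (i : Fin n) (k : ℕ)

/-- The boundary matrix on the vertices other than `i`, with columns the `k`-sets avoiding `i`. -/
noncomputable def avoidingBoundary : Matrix (Finset (Fin n)) (AvoidingFace i k) ℝ :=
  (boundaryOn ℝ (univ.erase i)).submatrix id Subtype.val

/-- The orthogonal projection onto the coboundaries on the `k`-sets avoiding `i`. -/
noncomputable def coboundaryProjection : Matrix (AvoidingFace i k) (AvoidingFace i k) ℝ :=
  (#(univ.erase i) : ℝ)⁻¹ • ((avoidingBoundary i k).transpose * avoidingBoundary i k)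

variable {i k}

theorem sum_avoidingFace {f : Finset (Fin n) → ℝ} (hf : ∀ σ, ¬ (#σ = k ∧ i ∉ σ) → f σ = 0) :
    ∑ σ : AvoidingFace i k, f σ.1 = ∑ σ, f σ := by
  rw [← Finset.sum_subtype (univ.filter fun σ => #σ = k ∧ i ∉ σ) (by simp) f]
  refine sum_subset (subset_univ _) fun σ _ hσ => hf σ ?_
  simpa using hσ

/-- This transfers identities between boundary matrices on all sets to the `k`-sets avoiding `i`,
for columns supported there. -/
theorem avoidingBoundary_mul (M : Matrix (Finset (Fin n)) (Finset (Fin n)) ℝ) {τ : Finset (Fin n)}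
    (hM : ∀ σ, ¬ (#σ = k ∧ i ∉ σ) → M σ τ = 0) (ρ : Finset (Fin n)) :
    ∑ σ : AvoidingFace i k, avoidingBoundary i k ρ σ * M σ.1 τ =
      (boundaryOn ℝ (univ.erase i) * M) ρ τ := by
  rw [Matrix.mul_apply, ← sum_avoidingFace (k := k) (i := i)]
  · rfl
  · intro σ hσ
    rw [hM σ hσ, mul_zero]

/-- Multiply the Laplacian identity by `∂` and use `∂∂ = 0`. -/
theorem boundaryOn_mul_transpose_mul_self (V : Finset (Fin n)) :
    boundaryOn ℝ V * ((boundaryOn ℝ V).transpose * boundaryOn ℝ V) = (#V : ℝ) • boundaryOn ℝ V := by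
  rw [← mul_assoc, eq_sub_of_add_eq (boundaryOn_laplacian ℝ V), sub_mul, mul_assoc,
    boundaryOn_mul_self, mul_zero, sub_zero, smul_mul_assoc, one_mul]

theorem avoidingBoundary_mul_transpose_mul_self :
    avoidingBoundary i k * ((avoidingBoundary i k).transpose * avoidingBoundary i k) =
      (#(univ.erase i) : ℝ) • avoidingBoundary i k := by
  ext ρ σ
  have h := congrFun (congrFun (boundaryOn_mul_transpose_mul_self (univ.erase i)) ρ) σ.1
  rw [← avoidingBoundary_mul (k := k)] at h
  · exact h
  · intro σ' hσ'
    rw [Matrix.mul_apply]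
    refine sum_eq_zero fun ρ' _ => ?_
    rw [Matrix.transpose_apply]
    by_contra hne
    have h1 := left_ne_zero_of_mul hne
    have h2 := right_ne_zero_of_mul hne
    have c1 := mt (boundaryOn_eq_zero_of_card ℝ) h1
    have c2 := mt (boundaryOn_eq_zero_of_card ℝ) h2
    have i1 := mt (boundaryOn_eq_zero_of_mem ℝ (notMem_erase i univ)) h1
    have i2 := mt (boundaryOn_eq_zero_of_mem ℝ (notMem_erase i univ)) h2
    push Not at c1 c2 i1 i2
    exact hσ' ⟨by rw [c1, ← c2, σ.2.1], fun h => σ.2.2 (i2.1 (i1.2 h))⟩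

theorem coboundaryProjection_isHermitian : (coboundaryProjection i k).IsHermitian := by
  rw [Matrix.IsHermitian, Matrix.conjTranspose_eq_transpose_of_trivial, coboundaryProjection,
    Matrix.transpose_smul, Matrix.transpose_mul, Matrix.transpose_transpose]

theorem coboundaryProjection_mul_self (hn : 2 ≤ n) :
    coboundaryProjection i k * coboundaryProjection i k = coboundaryProjection i k := by
  have h0 : (#(univ.erase i) : ℝ) ≠ 0 := by
    rw [card_erase_of_mem (mem_univ i), card_univ, Fintype.card_fin]
    exact_mod_cast (by omega : n - 1 ≠ 0)
  rw [coboundaryProjection, smul_mul_smul_comm, Matrix.mul_assoc, avoidingBoundary_mul_transpose_mul_self,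
    Matrix.mul_smul, smul_smul, mul_assoc, inv_mul_cancel₀ h0, mul_one]

/-- A `k`-set has `k` facets, so its boundary column has squared norm `k`. -/
theorem coboundaryProjection_diag (σ : AvoidingFace i k) :
    coboundaryProjection i k σ σ = k / #(univ.erase i) := by
  have h := transpose_boundaryOn_mul_self_diag ℝ (univ.erase i) σ.1
  rw [inter_eq_right.2 (subset_erase.2 ⟨subset_univ _, σ.2.2⟩), σ.2.1] at h
  rw [coboundaryProjection, Matrix.smul_apply, smul_eq_mul, div_eq_inv_mul, ← h]
  rfl

theorem mul_m₁ (hn : 2 ≤ n) (k : ℕ) : (n - 1).choose k * k = (n - 1) * m₁ n k := by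
  obtain ⟨m, rfl⟩ : ∃ m, n = m + 2 := ⟨n - 2, by omega⟩
  cases k with
  | zero => simp [m₁]
  | succ k => exact (Nat.add_one_mul_choose_eq m k).symm

theorem trace_coboundaryProjection (hn : 2 ≤ n) : (coboundaryProjection i k).trace = m₁ n k := by
  have h0 : ((n - 1 : ℕ) : ℝ) ≠ 0 := by exact_mod_cast (by omega : n - 1 ≠ 0)
  have h1 : ((n - 1).choose k : ℝ) * k = ((n - 1 : ℕ) : ℝ) * m₁ n k := by
    exact_mod_cast mul_m₁ hn k
  rw [Matrix.trace]
  simp only [Matrix.diag_apply, coboundaryProjection_diag]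
  rw [sum_const, card_univ, card_avoidingFace, card_erase_of_mem (mem_univ i), card_univ,
    Fintype.card_fin, nsmul_eq_mul, ← mul_div_assoc, h1, mul_div_cancel_left₀ _ h0]

end Projection

/-! ### Column norms and the determinant bound with a free parameter. -/

section Bound

variable {T : PreAbstractSimplicialComplex (Fin n)} {k : ℕ} {i : Fin n}
  (e : AvoidingFace i k ≃ facesOfCard T (k + 1))

theorem reducedBoundary_apply_of_notMem {j : AvoidingFace i k} (hj : i ∉ (e j).1)
    (σ : AvoidingFace i k) :
    reducedBoundary ℝ i e σ j = boundaryOn ℝ (univ.erase i) σ.1 (e j).1 := by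
  rw [reducedBoundary, Matrix.of_apply, boundaryOn_univ ℝ i, Matrix.add_apply, removal,
    Matrix.of_apply, if_neg (fun h => hj h.1), zero_add]

theorem reducedBoundary_apply_of_mem {j : AvoidingFace i k} (hj : i ∈ (e j).1)
    (σ : AvoidingFace i k) :
    reducedBoundary ℝ i e σ j =
      if σ.1 = (e j).1.erase i then vertexSign ℝ i (e j).1 else 0 := by
  rw [reducedBoundary, Matrix.of_apply, boundaryOn_univ ℝ i, Matrix.add_apply,
    boundaryOn_eq_zero_of_mem ℝ (notMem_erase i univ) (by simp [hj, σ.2.2]), add_zero, removal,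
    Matrix.of_apply]
  simp [hj]

theorem boundaryOn_erase_eq_zero {τ : Finset (Fin n)} (hτ : #τ = k + 1) (hi : i ∉ τ)
    (σ : Finset (Fin n)) (hσ : ¬ (#σ = k ∧ i ∉ σ)) : boundaryOn ℝ (univ.erase i) σ τ = 0 := by
  by_cases h : #σ = k
  · exact boundaryOn_eq_zero_of_mem ℝ (notMem_erase i univ) (by tauto)
  · exact boundaryOn_eq_zero_of_card ℝ (by omega)

theorem card_apply (j : AvoidingFace i k) : #(e j).1 = k + 1 := (mem_facesOfCard.1 (e j).2).1

/-- The column is the boundary of a face of the simplex on the vertices other than `i`, so `∂∂ = 0`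
kills it. -/
theorem coboundaryProjection_mul_reducedBoundary {j : AvoidingFace i k} (hj : i ∉ (e j).1)
    (σ : AvoidingFace i k) : (coboundaryProjection i k * reducedBoundary ℝ i e) σ j = 0 := by
  have h : ∀ ρ, (avoidingBoundary i k * reducedBoundary ℝ i e) ρ j = 0 := by
    intro ρ
    rw [Matrix.mul_apply]
    simp only [reducedBoundary_apply_of_notMem e hj]
    rw [avoidingBoundary_mul _ (boundaryOn_erase_eq_zero (card_apply e j) hj), boundaryOn_mul_self,
      Matrix.zero_apply]
  rw [coboundaryProjection, smul_mul_assoc, Matrix.mul_assoc, Matrix.smul_apply, Matrix.mul_apply,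
    sum_eq_zero (fun ρ _ => by rw [h ρ, mul_zero]), smul_zero]

theorem quadraticForm_of_notMem {j : AvoidingFace i k} (hj : i ∉ (e j).1) (c : ℝ) :
    ((reducedBoundary ℝ i e).transpose * ((1 + c • coboundaryProjection i k) *
      reducedBoundary ℝ i e)) j j = k + 1 := by
  rw [Matrix.mul_apply]
  simp only [add_mul, one_mul, smul_mul_assoc, Matrix.add_apply, Matrix.smul_apply,
    coboundaryProjection_mul_reducedBoundary e hj, smul_zero, add_zero, Matrix.transpose_apply,
    reducedBoundary_apply_of_notMem e hj]
  have h := transpose_boundaryOn_mul_self_diag ℝ (univ.erase i) (e j).1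
  rw [inter_eq_right.2 (subset_erase.2 ⟨subset_univ _, hj⟩), card_apply e, Matrix.mul_apply,
    ← sum_avoidingFace (k := k) (i := i)] at h
  · exact_mod_cast h
  · intro σ hσ
    rw [boundaryOn_erase_eq_zero (card_apply e j) hj σ hσ, mul_zero]

theorem quadraticForm_of_mem {j : AvoidingFace i k} (hj : i ∈ (e j).1) (c : ℝ) :
    ((reducedBoundary ℝ i e).transpose * ((1 + c • coboundaryProjection i k) *
      reducedBoundary ℝ i e)) j j = 1 + c * (k / #(univ.erase i)) := by
  -- The face opposite `i` is the only facet that avoids `i`, so the column has a single entry `±1`.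
  set σ₀ : AvoidingFace i k :=
    ⟨(e j).1.erase i, by rw [card_erase_of_mem hj, card_apply e]; rfl, notMem_erase _ _⟩
  have h : ∀ σ, reducedBoundary ℝ i e σ j =
      if σ = σ₀ then vertexSign ℝ i (e j).1 else 0 := by
    intro σ
    rw [reducedBoundary_apply_of_mem e hj]
    simp only [Subtype.ext_iff, σ₀]
  have h' : ∀ A : Matrix (AvoidingFace i k) (AvoidingFace i k) ℝ, ∀ σ,
      (A * reducedBoundary ℝ i e) σ j = A σ σ₀ * vertexSign ℝ i (e j).1 := by
    intro A σ
    simp only [Matrix.mul_apply, h, mul_ite, mul_zero, sum_ite_eq', mem_univ, if_true]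
  rw [← Matrix.mul_assoc, h', Matrix.mul_apply]
  simp only [Matrix.transpose_apply, h, ite_mul, zero_mul, sum_ite_eq', mem_univ, if_true]
  rw [mul_right_comm, vertexSign_mul_self, one_mul, Matrix.add_apply, Matrix.one_apply_eq,
    Matrix.smul_apply, coboundaryProjection_diag, smul_eq_mul]

theorem prod_ite_mem_facesOfCard (a b : ℝ) :
    ∏ j, (if i ∈ (e j).1 then a else b) =
      a ^ degree T k i * b ^ (#(facesOfCard T (k + 1)) - degree T k i) := by
  rw [Fintype.prod_equiv e _ (fun τ => if i ∈ τ.1 then a else b) (fun _ => rfl),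
    Finset.prod_coe_sort (facesOfCard T (k + 1)) (fun τ => if i ∈ τ then a else b),
    prod_ite, prod_const, prod_const]
  congr 2
  have := card_filter_add_card_filter_not (s := facesOfCard T (k + 1)) (fun τ => i ∈ τ)
  rw [degree]
  omega

/-- The one-parameter family of determinant bounds. -/
theorem pow_mul_det_sq_le (hn : 2 ≤ n) {s : ℝ} (hs : 0 < s) :
    s ^ m₁ n k * (reducedBoundary ℝ i e).det ^ 2 ≤
      (1 + (s - 1) * (k / ((n : ℝ) - 1))) ^ degree T k i *
        ((k : ℝ) + 1) ^ (#(facesOfCard T (k + 1)) - degree T k i) := by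
  set M := reducedBoundary ℝ i e
  set Q := coboundaryProjection i k
  -- Hadamard's inequality squares the scaling on the range of `Q`, so scaling by `√s` turns into `1
  -- + (s - 1) Q`.
  set t := Real.sqrt s
  have ht : t * t = s := Real.mul_self_sqrt hs.le
  have hQ : Q * Q = Q := coboundaryProjection_mul_self hn
  have hQt : Q.transpose = Q := coboundaryProjection_isHermitian
  have hS : (1 + (t - 1) • Q).transpose * (1 + (t - 1) • Q) = 1 + (s - 1) • Q := by
    rw [Matrix.transpose_add, Matrix.transpose_one, Matrix.transpose_smul, hQt, add_mul, mul_add,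
      mul_add, smul_mul_smul_comm, hQ, one_mul, one_mul, mul_one, add_assoc, ← add_smul,
      ← add_smul, ← ht]
    congr 2
    ring
  have hN : (#(univ.erase i) : ℝ) = (n : ℝ) - 1 := by
    rw [card_erase_of_mem (mem_univ i), card_univ, Fintype.card_fin, Nat.cast_sub (by omega),
      Nat.cast_one]
  have h := det_sq_le_prod_col ((1 + (t - 1) • Q) * M)
  rw [Matrix.det_mul, det_one_add_smul_projection coboundaryProjection_isHermitian hQ _
    (trace_coboundaryProjection hn), mul_pow, ← pow_mul, mul_comm _ 2, pow_mul, sq t, ht,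
    Matrix.transpose_mul, mul_assoc, ← mul_assoc _ _ M, hS] at h
  refine h.trans_eq ?_
  rw [← prod_ite_mem_facesOfCard e]
  refine prod_congr rfl fun j _ => ?_
  split_ifs with hj
  · rw [quadraticForm_of_mem e hj, hN]
  · exact quadraticForm_of_notMem e hj _

theorem m₃_eq_add (hn : 2 ≤ n) (k : ℕ) : m₃ n k = m₁ n k + m₂ n k := by
  obtain ⟨m, rfl⟩ : ∃ m, n = m + 2 := ⟨n - 2, by omega⟩
  cases k with
  | zero => simp [m₁, m₂, m₃]
  | succ k => exact Nat.choose_succ_succ m k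

end Bound

end QAcyclic

/-! ### The theorem: choice of the parameter. -/

theorem corollary3 (n k : ℕ) (hn : 2 ≤ n) (hkn : k < n)
    (T : PreAbstractSimplicialComplex (Fin n)) (hT : QAcyclic.IsQAcyclic T k)
    (i : Fin n) (d m₁ m₂ m₃ : ℕ) (hd : d = QAcyclic.degree T k i)
    (hm₁ : m₁ = QAcyclic.m₁ n k) (hm₂ : m₂ = QAcyclic.m₂ n k) (hm₃ : m₃ = QAcyclic.m₃ n k) :
    m₁ ≤ d ∧ d ≤ m₃ ∧
    Finite (QAcyclic.ReducedHomology ℤ T k) ∧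
    (m₁ < d →
      (Nat.card (QAcyclic.ReducedHomology ℤ T k) : ℝ) ^ 2 ≤
        (((d : ℝ) - m₁) / m₂) ^ m₁ *
          (1 + (k : ℝ) / ((n : ℝ) - 1) * (((m₃ : ℝ) - d) / ((d : ℝ) - m₁))) ^ d *
          ((k : ℝ) + 1) ^ (m₃ - d)) ∧
    (d = m₁ →
      (Nat.card (QAcyclic.ReducedHomology ℤ T k) : ℝ) ^ 2 ≤
        ((k : ℝ) / ((n : ℝ) - 1)) ^ m₁ * ((k : ℝ) + 1) ^ m₂) := by
  have e : QAcyclic.AvoidingFace i k ≃ QAcyclic.facesOfCard T (k + 1) :=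
    Fintype.equivOfCardEq (by rw [QAcyclic.card_avoidingFace, Fintype.card_coe, hT.card_faces])
  have hcard := QAcyclic.card_homology i hT e
  have hdet := QAcyclic.det_reducedBoundary_ne_zero i hT e
  have hsq : (Nat.card (QAcyclic.ReducedHomology ℤ T k) : ℝ) ^ 2 =
      (QAcyclic.reducedBoundary ℝ i e).det ^ 2 := by
    rw [hcard, QAcyclic.det_reducedBoundary_real, Nat.cast_natAbs, Int.cast_abs, sq_abs]
  have hpos : 0 < Nat.card (QAcyclic.ReducedHomology ℤ T k) := by
    rw [hcard]; exact Int.natAbs_pos.2 hdet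
  set x : ℝ := (Nat.card (QAcyclic.ReducedHomology ℤ T k) : ℝ) ^ 2
  have hx : 1 ≤ x := one_le_pow₀ (by exact_mod_cast hpos)
  have hF : (QAcyclic.facesOfCard T (k + 1)).card = m₃ := by rw [hT.card_faces, hm₃, QAcyclic.m₃]
  have hdm₃ : d ≤ m₃ := by rw [hd, ← hF]; exact Finset.card_filter_le _ _
  have hsum : m₃ = m₁ + m₂ := by rw [hm₁, hm₂, hm₃, QAcyclic.m₃_eq_add hn]
  have hbound : ∀ s : ℝ, 0 < s → s ^ m₁ * x ≤
      (1 + (s - 1) * (k / ((n : ℝ) - 1))) ^ d * ((k : ℝ) + 1) ^ (m₃ - d) := by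
    intro s hs
    have := QAcyclic.pow_mul_det_sq_le e hn hs
    rwa [← hsq, ← hm₁, ← hd, hF] at this
  have hn1 : (0 : ℝ) < (n : ℝ) - 1 := by
    have : (2 : ℝ) ≤ n := by exact_mod_cast hn
    linarith
  have hk0 : 0 ≤ (k : ℝ) / ((n : ℝ) - 1) := by positivity
  have hk1 : (k : ℝ) / ((n : ℝ) - 1) ≤ 1 := by
    rw [div_le_one hn1]
    have : (k : ℝ) + 1 ≤ n := by exact_mod_cast hkn
    linarith
  set r : ℝ := (k : ℝ) / ((n : ℝ) - 1)
  refine ⟨?_, hdm₃, Nat.finite_of_card_ne_zero hpos.ne', ?_, ?_⟩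
  · by_contra! hlt
    -- With `s = C + 1` and `r ≤ 1`, `d < m₁` would give `s ^ (d + 1) ≤ s ^ d * C`, that is, `C + 1
    -- ≤ C`.
    set C : ℝ := ((k : ℝ) + 1) ^ (m₃ - d)
    have hC : 0 < C := by positivity
    have h1 := hbound (C + 1) (by positivity)
    have h2 : (1 + (C + 1 - 1) * r) ^ d ≤ (C + 1) ^ d := by
      refine pow_le_pow_left₀ (by nlinarith) ?_ d
      nlinarith
    have h3 : (C + 1) ^ (d + 1) ≤ (C + 1) ^ m₁ := pow_le_pow_right₀ (by linarith) hlt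
    have h4 : (C + 1) ^ m₁ ≤ (C + 1) ^ m₁ * x := le_mul_of_one_le_right (by positivity) hx
    have h5 : (C + 1) ^ d * (C + 1) ≤ (C + 1) ^ d * C := by
      rw [← pow_succ]
      exact h3.trans (h4.trans (h1.trans (by gcongr)))
    linarith [le_of_mul_le_mul_left h5 (by positivity)]
  · intro hlt
    have hd0 : (0 : ℝ) < d - m₁ := by
      have : (m₁ : ℝ) < d := by exact_mod_cast hlt
      linarith
    have hm₂0 : (0 : ℝ) < m₂ := by exact_mod_cast (by omega : 0 < m₂)
    -- For `k > 0` this `s` minimises the bound on `x`, because `r = m₁ / m₃` and `1 - r = m₂ / m₃`;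
    -- for `k = 0` the bound does not depend on `s`.
    have h := hbound (m₂ / (d - m₁)) (by positivity)
    have hs : (m₂ : ℝ) / (d - m₁) - 1 = (m₃ - d) / (d - m₁) := by
      rw [hsum]; push_cast; field_simp; ring
    rw [hs, mul_comm _ r] at h
    rw [mul_assoc, ← inv_div (m₂ : ℝ), inv_pow, ← div_eq_inv_mul, le_div_iff₀ (by positivity),
      mul_comm x]
    exact h
  · intro hdm
    have hsub : m₃ - d = m₂ := by omega
    -- Here `u = 1 / s`: as `d = m₁`, the factor `s ^ m₁` is absorbed into the `d`-th power, and
    -- letting `u → 0` gives the bound.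
    have hu : ∀ u : ℝ, 0 < u → x ≤ (u + (1 - u) * r) ^ m₁ * ((k : ℝ) + 1) ^ m₂ := by
      intro u hu
      have h := hbound u⁻¹ (by positivity)
      rw [hsub, hdm] at h
      have h' : x = u ^ m₁ * (u⁻¹ ^ m₁ * x) := by
        rw [← mul_assoc, ← mul_pow, mul_inv_cancel₀ hu.ne', one_pow, one_mul]
      rw [h']
      refine (mul_le_mul_of_nonneg_left h (by positivity)).trans_eq ?_
      rw [← mul_assoc, ← mul_pow]
      congr 2
      field_simp
    have hlim : Filter.Tendsto (fun u : ℝ => (u + (1 - u) * r) ^ m₁ * ((k : ℝ) + 1) ^ m₂)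
        (nhdsWithin 0 (Set.Ioi 0)) (nhds (r ^ m₁ * ((k : ℝ) + 1) ^ m₂)) := by
      have hc : Continuous fun u : ℝ => (u + (1 - u) * r) ^ m₁ * ((k : ℝ) + 1) ^ m₂ := by fun_prop
      have := hc.tendsto 0
      simp only [zero_add, sub_zero, one_mul] at this
      exact this.mono_left nhdsWithin_le_nhds
    exact ge_of_tendsto hlim (eventually_mem_nhdsWithin.mono hu)
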